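/- Let $\Bbbk$ be a field and let $H$ be a Hopf algebra over $\Bbbk$ with counit $\varepsilon$ (the antipode is not assumed bijective and $H$ is not assumed Noetherian). Let $H^e=H\otimes_{\Bbbk}H^{op}$ be the enveloping algebra, and let ${}_\varepsilon\Bbbk$ and $\Bbbk_\varepsilon$ be the left and right trivial $H$-modules, that is, $\Bbbk$ with $h\cdot c=\varepsilon(h)c$ and with $c\cdot h=c\,\varepsilon(h)$, respectively. The following assertions are equivalent: (i) $H$ is homologically smooth, that is, $H$, regarded as an $H^e$-module via $(a\otimes b)\cdot x=axb$, has a bounded resolution $0\to P_n\to\cdots\to P_1\to P_0\to H\to 0$ by finitely generated projective $H^e$-modules. (ii) The left trivial module ${}_\varepsilon\Bbbk$ admits a bounded projective resolution with each term a finitely generated left $H$-module. (iii) The right trivial module $\Bbbk_\varepsilon$ admits a bounded projective resolution with each term a finitely generated right $H$-module. -/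

import Mathlib

open scoped TensorProduct

universe u v w

/-- A bounded resolution `0 → X n → ⋯ → X 1 → X 0 → M → 0` of a (left) `R`-module `M` by finitely
generated projective `R`-modules. (A finitely generated `R`-module is isomorphic to one in the
universe of `R`, so taking the terms there is no restriction.) -/
structure BoundedFGProjectiveResolution (R : Type v) [Ring R] (M : Type w) [AddCommGroup M]
    [Module R M] where
  /-- The terms. -/
  X : ℕ → Type v
  [addCommGroup : ∀ i, AddCommGroup (X i)]
  [module : ∀ i, Module R (X i)]
  /-- The differentials. -/
  d : ∀ i, X (i + 1) →ₗ[R] X i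
  /-- The augmentation. -/
  aug : X 0 →ₗ[R] M
  finite : ∀ i, Module.Finite R (X i)
  projective : ∀ i, Module.Projective R (X i)
  bounded : ∃ n, ∀ i, n < i → Subsingleton (X i)
  aug_surjective : Function.Surjective aug
  exact_zero : Function.Exact (d 0) aug
  exact_succ : ∀ i, Function.Exact (d (i + 1)) (d i)

/-- A `k`-algebra `A` is homologically smooth if the bimodule `A`, that is, the module `A` over the
enveloping algebra `A ⊗[k] Aᵐᵒᵖ` with `(a ⊗ op b) • x = a * x * b`, has a bounded resolution by
finitely generated projective modules over the enveloping algebra. -/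
def IsHomologicallySmooth (k : Type u) (A : Type v) [Field k] [Ring A] [Algebra k A] : Prop :=
  letI : Module (A ⊗[k] Aᵐᵒᵖ) A := instModuleTensorProductMop k A
  Nonempty (BoundedFGProjectiveResolution (A ⊗[k] Aᵐᵒᵖ) A)

/-- The field `k`, carrying the trivial left and right module structures over the bialgebra `H`
defined by the counit. Right `H`-modules are modules over `Hᵐᵒᵖ`. -/
def TrivialModule (k : Type u) (_H : Type v) : Type u := k

namespace TrivialModule

variable (k : Type u) (H : Type v) [Field k] [Ring H] [Bialgebra k H]

instance : AddCommGroup (TrivialModule k H) := inferInstanceAs (AddCommGroup k)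

/-- The left action `h • c = ε(h) c`. -/
instance instLeft : Module H (TrivialModule k H) :=
  Module.compHom k (Bialgebra.counitAlgHom k H : H →+* k)

/-- The right action `c ◂ h = c ε(h)`. -/
instance instRight : Module Hᵐᵒᵖ (TrivialModule k H) :=
  Module.compHom k ((Bialgebra.counitAlgHom k H : H →+* k).fromOpposite fun _ _ => Commute.all _ _)

theorem left_smul_def (h : H) (c : k) :
    (h • (show TrivialModule k H from c)) = (Coalgebra.counit (R := k) h * c : k) := rfl

theorem right_smul_def (h : H) (c : k) :
    (MulOpposite.op h • (show TrivialModule k H from c)) = (c * Coalgebra.counit (R := k) h : k) :=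
  mul_comm (Coalgebra.counit (R := k) h : k) c

end TrivialModule

-- Both directions apply a functor to a resolution; it must preserve exactness and finitely
-- generated projectives, and exchange the bimodule `H` with the trivial module.
--
-- From bimodules to left modules the functor is `P ↦ P ⊗_H k`, realised as `P / (ker φ) P` for `φ :
-- H ⊗ Hᵐᵒᵖ → H`, `a ⊗ c ↦ ε(c) a`. It is not exact in general, but a bimodule resolution of `H`
-- consists of projective right `H`-modules and resolves a free one, so it is contractible over
-- `Hᵐᵒᵖ`; the contraction survives in the quotient (`BoundedFGProjectiveResolution.reduction`). The
-- right-hand case kills the other tensor factor.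
--
-- Conversely, send a left module `P` to the bimodule `P ⊗ H` with `(a ⊗ c)(p ⊗ x) = a₁p ⊗ a₂xc`.
-- This is exact over a field and sends the trivial module to `H`. It sends `H` to a free bimodule
-- of rank one on `1 ⊗ 1`, because the Galois map `a ⊗ b ↦ a₁ ⊗ a₂b` has inverse `a ⊗ b ↦ a₁ ⊗
-- S(a₂)b`. For right modules the action is `(a ⊗ c)(p ⊗ x) = pc₂ ⊗ axc₁`, with Galois map `a ⊗ b ↦
-- ab₁ ⊗ b₂` and inverse `a ⊗ b ↦ aS(b₁) ⊗ b₂`. These orderings need only `S`, never its inverse.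

attribute [instance] BoundedFGProjectiveResolution.addCommGroup
  BoundedFGProjectiveResolution.module

/-- Transport of a resolution along an isomorphism of the resolved modules. -/
def BoundedFGProjectiveResolution.ofEquiv {R : Type v} [Ring R] {M : Type w} [AddCommGroup M]
    [Module R M] {M' : Type*} [AddCommGroup M'] [Module R M']
    (P : BoundedFGProjectiveResolution R M) (e : M ≃ₗ[R] M') :
    BoundedFGProjectiveResolution R M' where
  X := P.X
  d := P.d
  aug := e.toLinearMap ∘ₗ P.aug
  finite := P.finite
  projective := P.projective
  bounded := P.bounded
  aug_surjective := e.surjective.comp P.aug_surjective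
  exact_zero := fun x => by simpa using P.exact_zero x
  exact_succ := P.exact_succ

/-- Makes the terms of a resolution over `B` projective over `R`, as the contractions below require.
-/
theorem Module.Projective.of_isScalarTower (R S P : Type*) [Ring R] [Ring S] [AddCommGroup P]
    [Module R S] [Module R P] [Module S P] [IsScalarTower R S P] [IsScalarTower R S S]
    [Module.Projective R S] [Module.Projective S P] : Module.Projective R P := by
  classical
  obtain ⟨s, hs⟩ := Module.projective_def'.1 ‹Module.Projective S P›
  have : Module.Projective R (P →₀ S) :=
    Module.Projective.of_equiv' (finsuppLEquivDirectSum R S P).symm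
  exact Module.Projective.of_split (M := P →₀ S) (s.restrictScalars R)
    ((Finsupp.linearCombination S (id : P → P)).restrictScalars R)
    (LinearMap.ext fun x => LinearMap.congr_fun hs x)

/-! ### Contractions of projective resolutions of projective modules -/

section Contraction

variable {R : Type*} [Ring R] {M : Type*} [AddCommGroup M] [Module R M]

theorem Module.Projective.exists_comp_eq_of_exact {P N N' N'' : Type*} [AddCommGroup P]
    [Module R P] [Module.Projective R P] [AddCommGroup N] [Module R N] [AddCommGroup N']
    [Module R N'] [AddCommGroup N''] [Module R N''] {f : N →ₗ[R] N'} {g : N' →ₗ[R] N''}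
    (h : Function.Exact f g) (q : P →ₗ[R] N') (hq : ∀ x, g (q x) = 0) :
    ∃ s : P →ₗ[R] N, ∀ x, f (s x) = q x := by
  obtain ⟨s, hs⟩ := Module.projective_lifting_property f.rangeRestrict
    (q.codRestrict (LinearMap.range f) fun x => (h (q x)).1 (hq x)) f.surjective_rangeRestrict
  exact ⟨s, fun x => congrArg Subtype.val (LinearMap.congr_fun hs x)⟩

variable {X : ℕ → Type*} [∀ i, AddCommGroup (X i)] [∀ i, Module R (X i)]
  [∀ i, Module.Projective R (X i)] [Module.Projective R M]
  {d : ∀ i, X (i + 1) →ₗ[R] X i} {aug : X 0 →ₗ[R] M}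

theorem exists_contraction_zero (h : Function.Surjective aug) (h₀ : Function.Exact (d 0) aug) :
    ∃ (s : M →ₗ[R] X 0) (t : X 0 →ₗ[R] X 1), ∀ x, d 0 (t x) + s (aug x) = x := by
  obtain ⟨s, hs⟩ := Module.projective_lifting_property aug LinearMap.id h
  have hs' : ∀ x, aug (s x) = x := fun x => LinearMap.congr_fun hs x
  obtain ⟨t, ht⟩ := Module.Projective.exists_comp_eq_of_exact h₀ (LinearMap.id - s ∘ₗ aug)
    (fun x => by simp [hs'])
  exact ⟨s, t, fun x => by simp [ht]⟩

/-- The homotopy is produced one degree at a time; exactness after reduction uses a single degree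
only, so no compatible family is needed. -/
theorem exists_contraction_succ (h : Function.Surjective aug) (h₀ : Function.Exact (d 0) aug)
    (h₁ : ∀ i, Function.Exact (d (i + 1)) (d i)) (i : ℕ) :
    ∃ (s : X i →ₗ[R] X (i + 1)) (t : X (i + 1) →ₗ[R] X (i + 1 + 1)),
      ∀ x, d (i + 1) (t x) + s (d i x) = x := by
  induction i with
  | zero =>
    obtain ⟨r, s, hs⟩ := exists_contraction_zero h h₀
    obtain ⟨t, ht⟩ := Module.Projective.exists_comp_eq_of_exact (h₁ 0) (LinearMap.id - s ∘ₗ d 0)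
      (fun x => by
        have := hs (d 0 x)
        rw [h₀.apply_apply_eq_zero, map_zero, add_zero] at this
        simp [this])
    exact ⟨s, t, fun x => by simp [ht]⟩
  | succ i ih =>
    -- The second map of degree `i` becomes the first map of degree `i + 1`. The old identity at `d
    -- (i + 1) x` shows that `x - s (d (i + 1) x)` is a cycle, which projectivity lifts.
    obtain ⟨r, s, hs⟩ := ih
    obtain ⟨t, ht⟩ := Module.Projective.exists_comp_eq_of_exact (h₁ (i + 1))
      (LinearMap.id - s ∘ₗ d (i + 1))
      (fun x => by
        have := hs (d (i + 1) x)
        rw [(h₁ i).apply_apply_eq_zero, map_zero, add_zero] at this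
        simp [this])
    exact ⟨s, t, fun x => by simp [ht]⟩

end Contraction

/-! ### Reduction modulo the kernel of a retraction of rings -/

section Reduction

variable {A B : Type v} [Ring A] [Ring B] (i : A →+* B) (φ : B →+* A)

/-- The quotient of a `B`-module by the submodule generated by the action of `ker φ`. -/
def KerQuotient (_i : A →+* B) (φ : B →+* A) (P : Type*) [AddCommGroup P] [Module B P] :
    Type _ :=
  P ⧸ (RingHom.ker φ • (⊤ : Submodule B P))

namespace KerQuotient

section

variable (P : Type*) [AddCommGroup P] [Module B P]

instance : AddCommGroup (KerQuotient i φ P) :=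
  inferInstanceAs (AddCommGroup (P ⧸ (RingHom.ker φ • (⊤ : Submodule B P))))

instance instModuleOver : Module B (KerQuotient i φ P) :=
  inferInstanceAs (Module B (P ⧸ (RingHom.ker φ • (⊤ : Submodule B P))))

/-- The `A`-module structure on the quotient, by restriction along the section `i` of `φ`. -/
instance instModule : Module A (KerQuotient i φ P) := Module.compHom _ i

/-- The quotient map. -/
def mkQ : P →ₗ[B] KerQuotient i φ P := Submodule.mkQ _

end

variable {P P' : Type*} [AddCommGroup P] [Module B P] [AddCommGroup P'] [Module B P']

theorem mkQ_surjective : Function.Surjective (mkQ i φ P) := Submodule.mkQ_surjective _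

theorem mkQ_eq_zero {x : P} : mkQ i φ P x = 0 ↔ x ∈ RingHom.ker φ • (⊤ : Submodule B P) :=
  Submodule.Quotient.mk_eq_zero _

theorem smul_def (a : A) (x : KerQuotient i φ P) : a • x = i a • x := rfl

variable {i φ}

/-- The element `b - i (φ b)` lies in `ker φ`, so the `B`-action on the quotient factors through
`φ`. -/
theorem smul_eq (hi : ∀ a, φ (i a) = a) (b : B) (x : KerQuotient i φ P) : φ b • x = b • x := by
  obtain ⟨x, rfl⟩ := mkQ_surjective i φ x
  rw [smul_def, ← map_smul, ← map_smul, ← sub_eq_zero, ← map_sub, ← sub_smul, mkQ_eq_zero]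
  exact Submodule.smul_mem_smul (by simp [RingHom.mem_ker, hi]) trivial

theorem apply_eq_zero (f : P →ₗ[B] P') (hf : ∀ b x, φ b = 0 → b • f x = 0) {x : P}
    (hx : x ∈ RingHom.ker φ • (⊤ : Submodule B P)) : f x = 0 := by
  have : RingHom.ker φ • (⊤ : Submodule B P) ≤ LinearMap.ker f := by
    rw [Submodule.smul_le]
    intro b hb x _
    rw [LinearMap.mem_ker, map_smul, hf _ _ ((RingHom.mem_ker).1 hb)]
  exact this hx

variable (i) in
/-- The map induced on the quotient by a linear map into a module on which `ker φ` acts by zero. -/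
def lift (f : P →ₗ[B] P') (hf : ∀ b x, φ b = 0 → b • f x = 0) : KerQuotient i φ P →ₗ[B] P' :=
  Submodule.liftQ _ f fun _ hx => apply_eq_zero f hf hx

variable (i φ) in
/-- Functoriality of the quotient, over `B`. -/
def mapOver (f : P →ₗ[B] P') : KerQuotient i φ P →ₗ[B] KerQuotient i φ P' :=
  lift i (mkQ i φ P' ∘ₗ f) fun b x hb => by
    rw [LinearMap.comp_apply, ← map_smul, mkQ_eq_zero]
    exact Submodule.smul_mem_smul hb trivial

variable (i φ) in
/-- Functoriality of the quotient. -/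
def map (f : P →ₗ[B] P') : KerQuotient i φ P →ₗ[A] KerQuotient i φ P' where
  toFun := mapOver i φ f
  map_add' := map_add _
  map_smul' a x := map_smul (mapOver i φ f) (i a) x

@[simp]
theorem map_mkQ (f : P →ₗ[B] P') (x : P) : map i φ f (mkQ i φ P x) = mkQ i φ P' (f x) := rfl

theorem finite (hi : ∀ a, φ (i a) = a) [Module.Finite B P] :
    Module.Finite A (KerQuotient i φ P) := by
  obtain ⟨s, hs⟩ := Module.Finite.fg_top (R := B) (M := P)
  classical
  refine ⟨s.image (mkQ i φ P), ?_⟩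
  rw [eq_top_iff]
  rintro x -
  obtain ⟨x, rfl⟩ := mkQ_surjective i φ x
  have hx : x ∈ Submodule.span B (s : Set P) := hs ▸ trivial
  induction hx using Submodule.span_induction with
  | mem x hx => exact Submodule.subset_span (by simpa using ⟨x, hx, rfl⟩)
  | zero => rw [map_zero]; exact zero_mem _
  | add x y _ _ hx hy => rw [map_add]; exact add_mem hx hy
  | smul b x _ hx =>
    rw [map_smul, ← smul_eq hi]
    exact Submodule.smul_mem _ _ hx

/-- Base change along `φ` preserves projectives: a surjection from a free `A`-module, viewed over
`B` through `φ`, is lifted against `P`, and the lift kills `(ker φ) P`. -/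
theorem projective (hi : ∀ a, φ (i a) = a) {P : Type v} [AddCommGroup P] [Module B P]
    [Module.Projective B P] :
    Module.Projective A (KerQuotient i φ P) := by
  refine Module.Projective.of_lifting_property'' fun f hf => ?_
  let _ : Module B (KerQuotient i φ P →₀ A) := Module.compHom _ φ
  have hsmul : ∀ (b : B) (x : KerQuotient i φ P →₀ A), b • x = φ b • x := fun _ _ => rfl
  let f' : (KerQuotient i φ P →₀ A) →ₗ[B] KerQuotient i φ P :=
    { toFun := f
      map_add' := map_add f
      map_smul' := fun b x => by rw [hsmul, map_smul, smul_eq hi, RingHom.id_apply] }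
  obtain ⟨g, hg⟩ := Module.projective_lifting_property f' (mkQ i φ P) hf
  refine ⟨{ toFun := lift i g fun b x hb => by rw [hsmul, hb, zero_smul]
            map_add' := map_add _
            map_smul' := fun a x => ?_ }, ?_⟩
  · rw [smul_def, map_smul, hsmul, hi, RingHom.id_apply]
  · ext x
    obtain ⟨x, rfl⟩ := mkQ_surjective i φ x
    exact LinearMap.congr_fun hg x

/-- As `ker φ` is generated by `j J` as a right ideal, `(ker φ) P = j(J) P`. Hence linearity over
`R` suffices to preserve it, and this is all that a contraction over `R` offers. -/
theorem mem_of_additive {R : Type*} [Ring R] {j : R →+* B} {J : Ideal R}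
    (hker : ∀ b, φ b = 0 → b ∈ AddSubmonoid.closure {x | ∃ r ∈ J, ∃ b, x = j r * b})
    (hJ : ∀ r ∈ J, φ (j r) = 0) (f : P →+ P') (hf : ∀ r x, f (j r • x) = j r • f x) {x : P}
    (hx : x ∈ RingHom.ker φ • (⊤ : Submodule B P)) :
    f x ∈ RingHom.ker φ • (⊤ : Submodule B P') := by
  have key : ∀ b, φ b = 0 → ∀ x, f (b • x) ∈ RingHom.ker φ • (⊤ : Submodule B P') := by
    intro b hb x
    have := hker b hb
    clear hb
    induction this using AddSubmonoid.closure_induction with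
    | mem b hb =>
      obtain ⟨r, hr, b, rfl⟩ := hb
      rw [mul_smul, hf]
      exact Submodule.smul_mem_smul (hJ r hr) trivial
    | zero => simp
    | add b c _ _ hb hc => rw [add_smul, map_add]; exact add_mem hb hc
  exact Submodule.smul_induction_on hx (fun b hb x _ => key b hb x)
    fun x y hx hy => by rw [map_add]; exact add_mem hx hy

end KerQuotient

open KerQuotient in
/-- Let `φ : B → A` be a retraction of rings whose kernel is generated by an ideal `J` of a ring `R`
over which `B` is projective. Reduction modulo `ker φ` carries bounded resolutions by finitely
generated projective modules of an `R`-projective `B`-module `M` to such resolutions of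
`M / (ker φ) M` over `A`. -/
theorem BoundedFGProjectiveResolution.reduction {R : Type*} [Ring R] {j : R →+* B} {J : Ideal R}
    (hi : ∀ a, φ (i a) = a)
    (hker : ∀ b, φ b = 0 → b ∈ AddSubmonoid.closure {x | ∃ r ∈ J, ∃ b, x = j r * b})
    (hJ : ∀ r ∈ J, φ (j r) = 0)
    (hB : letI : Module R B := Module.compHom B j; Module.Projective R B)
    {M : Type*} [AddCommGroup M] [Module B M]
    (hM : letI : Module R M := Module.compHom M j; Module.Projective R M)
    {M₀ : Type*} [AddCommGroup M₀] [Module A M₀] (π : M →+ M₀)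
    (hπ : ∀ b m, π (b • m) = φ b • π m) (hπs : Function.Surjective π)
    (hπk : ∀ m, π m = 0 → m ∈ RingHom.ker φ • (⊤ : Submodule B M))
    (P : BoundedFGProjectiveResolution B M) :
    Nonempty (BoundedFGProjectiveResolution A M₀) := by
  let _ : Module A M := Module.compHom M i
  let _ : Module B M₀ := Module.compHom M₀ φ
  have hsmul : ∀ (b : B) (x : M₀), b • x = φ b • x := fun _ _ => rfl
  let π' : M →ₗ[B] M₀ := { toFun := π, map_add' := map_add π, map_smul' := hπ }
  have hπ' : ∀ b x, φ b = 0 → b • π' x = 0 := fun b x hb => by rw [hsmul, hb, zero_smul]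
  let aug : KerQuotient i φ (P.X 0) →ₗ[A] M₀ :=
    { toFun := lift i (π' ∘ₗ P.aug) fun b x hb => hπ' b _ hb
      map_add' := map_add _
      map_smul' := fun a x => by rw [smul_def, map_smul, hsmul, hi, RingHom.id_apply] }
  have haug : ∀ x, aug (mkQ i φ _ x) = π (P.aug x) := fun _ => rfl
  let _ : Module R B := Module.compHom B j
  let _ : ∀ n, Module R (P.X n) := fun n => Module.compHom (P.X n) j
  let _ : Module R M := Module.compHom M j
  have hsmulX : ∀ n (r : R) (x : P.X n), r • x = j r • x := fun _ _ _ => rfl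
  have hsmulM : ∀ (r : R) (x : M), r • x = j r • x := fun _ _ => rfl
  have : ∀ n, IsScalarTower R B (P.X n) := fun n => ⟨fun r b x => mul_smul (j r) b x⟩
  have : IsScalarTower R B M := ⟨fun r b x => mul_smul (j r) b x⟩
  have : IsScalarTower R B B := ⟨fun r b x => mul_assoc (j r) b x⟩
  have hproj : ∀ n, Module.Projective R (P.X n) := fun n => by
    have := P.projective n
    exact Module.Projective.of_isScalarTower R B (P.X n)
  obtain ⟨s₀, t₀, h₀⟩ := exists_contraction_zero (R := R)
    (d := fun n => (P.d n).restrictScalars R) (aug := P.aug.restrictScalars R)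
    P.aug_surjective P.exact_zero
  refine ⟨{ X := fun n => KerQuotient i φ (P.X n)
            d := fun n => map i φ (P.d n)
            aug := aug
            finite := fun n => have := P.finite n; KerQuotient.finite hi
            projective := fun n => have := P.projective n; KerQuotient.projective hi
            bounded := ?_
            aug_surjective := ?_
            exact_zero := ?_
            exact_succ := ?_ }⟩
  · obtain ⟨n, hn⟩ := P.bounded
    exact ⟨n, fun m hm => have := hn m hm; (mkQ_surjective i φ).subsingleton⟩
  · intro x
    obtain ⟨m, rfl⟩ := hπs x
    obtain ⟨y, rfl⟩ := P.aug_surjective m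
    exact ⟨mkQ i φ _ y, rfl⟩
  · intro x
    obtain ⟨x, rfl⟩ := mkQ_surjective i φ x
    constructor
    · intro hx
      refine ⟨mkQ i φ _ (t₀ x), ?_⟩
      -- The contraction gives `x - d (t₀ x) = s₀ (aug x)`, and `aug x` lies in `(ker φ) M`, so the
      -- difference dies in the quotient.
      rw [map_mkQ, ← sub_eq_zero, ← map_sub, ← neg_eq_zero, ← map_neg, mkQ_eq_zero, neg_sub]
      have := mem_of_additive hker hJ s₀.toAddMonoidHom (fun r x => map_smul s₀ r x)
        (hπk _ hx)
      convert this using 1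
      exact sub_eq_of_eq_add' (h₀ x).symm
    · rintro ⟨y, hy⟩
      obtain ⟨y, rfl⟩ := mkQ_surjective i φ y
      rw [← hy, map_mkQ, haug, P.exact_zero.apply_apply_eq_zero, map_zero]
  · intro n x
    obtain ⟨x, rfl⟩ := mkQ_surjective i φ x
    constructor
    · intro hx
      obtain ⟨s, t, h⟩ := exists_contraction_succ (R := R)
        (d := fun n => (P.d n).restrictScalars R) (aug := P.aug.restrictScalars R)
        P.aug_surjective P.exact_zero P.exact_succ n
      refine ⟨mkQ i φ _ (t x), ?_⟩
      rw [map_mkQ, ← sub_eq_zero, ← map_sub, ← neg_eq_zero, ← map_neg, mkQ_eq_zero, neg_sub]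
      rw [map_mkQ, mkQ_eq_zero] at hx
      have := mem_of_additive hker hJ s.toAddMonoidHom (fun r x => map_smul s r x) hx
      convert this using 1
      exact sub_eq_of_eq_add' (h x).symm
    · rintro ⟨y, hy⟩
      obtain ⟨y, rfl⟩ := mkQ_surjective i φ y
      rw [← hy, map_mkQ, map_mkQ, (P.exact_succ n).apply_apply_eq_zero, map_zero]

end Reduction

section

variable {k : Type*} [CommRing k] {A B R : Type*} [Ring A] [Ring B] [Ring R] [Algebra k A]
  [Algebra k B] [Algebra k R]

/-- If `B` is additively spanned by the products `j r * i a`, and `φ : B → A` satisfies `φ ∘ i = id`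
and `φ ∘ j = ε`, then the kernel of `φ` is generated by the augmentation ideal of `R`. -/
theorem ker_le_closure_augmentation (i : A →ₐ[k] B) (j : R →ₐ[k] B) (φ : B →ₐ[k] A)
    (ε : R →ₐ[k] k) (hi : ∀ a, φ (i a) = a) (hj : ∀ r, φ (j r) = algebraMap k A (ε r))
    (hB : ∀ b, b ∈ AddSubmonoid.closure {x | ∃ r a, x = j r * i a}) (b : B) (hb : φ b = 0) :
    b ∈ AddSubmonoid.closure {x | ∃ r ∈ RingHom.ker ε, ∃ b, x = j r * b} := by
  -- The condition `φ b = 0` does not pass to summands, so the claim is proved for `b - i (φ b)`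
  -- with `b` arbitrary.
  have key : b - i (φ b) ∈ AddSubmonoid.closure {x | ∃ r ∈ RingHom.ker ε, ∃ b, x = j r * b} := by
    clear hb
    induction hB b using AddSubmonoid.closure_induction with
    | mem x hx =>
      obtain ⟨r, a, rfl⟩ := hx
      refine AddSubmonoid.subset_closure ⟨r - algebraMap k R (ε r), by simp [RingHom.mem_ker],
        i a, ?_⟩
      simp [hi, hj, sub_mul]
    | zero => simp
    | add x y _ _ hx hy =>
      rw [map_add, map_add, add_sub_add_comm]
      exact add_mem hx hy
  simpa [hb] using key

end

theorem Module.Projective.compHom_of_addEquiv {R B N : Type*} [Ring R] [Ring B] (j : R →+* B)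
    [AddCommGroup N] [Module R N] [Module.Projective R N] {P : Type*} [AddCommGroup P] [Module B P]
    (e : N ≃+ P) (he : ∀ r x, e (r • x) = j r • e x) :
    letI : Module R P := Module.compHom P j
    Module.Projective R P :=
  let _ : Module R P := Module.compHom P j
  Module.Projective.of_equiv' (M := N) { e with map_smul' := he }

/-! ### From bimodule resolutions of `H` to resolutions of the trivial modules -/

section Enveloping

open MulOpposite

variable {k : Type u} {H : Type v} [Field k] [Ring H]

theorem TensorProduct.projective_includeLeft [Algebra k H] (R : Type*) [Ring R] [Algebra k R] :
    letI : Module H (H ⊗[k] R) :=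
      Module.compHom _ (Algebra.TensorProduct.includeLeft : H →ₐ[k] H ⊗[k] R).toRingHom
    Module.Projective H (H ⊗[k] R) :=
  Module.Projective.compHom_of_addEquiv (N := H ⊗[k] R) _ (AddEquiv.refl _) fun r x => by
    change r • x = (r ⊗ₜ 1) * x
    induction x with
    | zero => simp
    | add x y hx hy => rw [smul_add, mul_add, hx, hy]
    | tmul x y => simp [TensorProduct.smul_tmul']

theorem TensorProduct.projective_includeRight [Algebra k H] (R : Type*) [Ring R] [Algebra k R] :
    letI : Module R (H ⊗[k] R) :=
      Module.compHom _ (Algebra.TensorProduct.includeRight : R →ₐ[k] H ⊗[k] R).toRingHom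
    Module.Projective R (H ⊗[k] R) :=
  Module.Projective.compHom_of_addEquiv (N := R ⊗[k] H) _
    (TensorProduct.comm k R H).toAddEquiv fun r x => by
    change TensorProduct.comm k R H (r • x) = (1 ⊗ₜ r) * TensorProduct.comm k R H x
    induction x with
    | zero => simp
    | add x y hx hy => rw [smul_add, map_add, map_add, mul_add, hx, hy]
    | tmul x y => simp [TensorProduct.smul_tmul']

variable (k H) in
/-- The counit as a character of the opposite algebra. -/
def counitOp [Bialgebra k H] : Hᵐᵒᵖ →ₐ[k] k :=
  (Bialgebra.counitAlgHom k H).fromOpposite fun _ _ => Commute.all _ _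

@[simp]
theorem counitOp_op [Bialgebra k H] (h : H) : counitOp k H (op h) = Coalgebra.counit (R := k) h :=
  rfl

section

variable [Algebra k H]

/-- `H` as a module over its enveloping algebra. -/
abbrev instModuleEnveloping : Module (H ⊗[k] Hᵐᵒᵖ) H := instModuleTensorProductMop k H

attribute [local instance] instModuleEnveloping

theorem enveloping_smul_def (b : H ⊗[k] Hᵐᵒᵖ) (x : H) :
    b • x = AlgHom.mulLeftRight k H b x := rfl

theorem enveloping_tmul_smul (a : H) (c : Hᵐᵒᵖ) (x : H) :
    (a ⊗ₜ[k] c) • x = a * x * unop c := by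
  rw [enveloping_smul_def, AlgHom.mulLeftRight_apply]

end

attribute [local instance] instModuleEnveloping

variable [Bialgebra k H]

theorem counit_enveloping_tmul_smul (a : H) (c : Hᵐᵒᵖ) (x : H) :
    Coalgebra.counit (R := k) ((a ⊗ₜ[k] c) • x) =
      Coalgebra.counit (R := k) a * counitOp k H c * Coalgebra.counit (R := k) x := by
  rw [enveloping_tmul_smul, Bialgebra.counit_mul, Bialgebra.counit_mul, mul_right_comm]
  rfl

variable (k H) in
/-- The counit, with values in the trivial module. -/
def TrivialModule.counit : H →+ TrivialModule k H :=
  (Coalgebra.counit (R := k) (A := H)).toAddMonoidHom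

theorem TrivialModule.counit_surjective : Function.Surjective (TrivialModule.counit k H) :=
  fun c => ⟨algebraMap k H (show k from c), Bialgebra.counit_algebraMap (show k from c)⟩

theorem IsHomologicallySmooth.left (h : IsHomologicallySmooth k H) :
    Nonempty (BoundedFGProjectiveResolution H (TrivialModule k H)) := by
  obtain ⟨P⟩ := h
  have hcomm : ∀ (x : H) (y : Hᵐᵒᵖ), Commute (AlgHom.id k H x)
    ((Algebra.ofId k H).comp (counitOp k H) y) := fun x y => (Algebra.commutes _ _).symm
  let i : H →ₐ[k] H ⊗[k] Hᵐᵒᵖ := Algebra.TensorProduct.includeLeft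
  let j : Hᵐᵒᵖ →ₐ[k] H ⊗[k] Hᵐᵒᵖ := Algebra.TensorProduct.includeRight
  let φ : H ⊗[k] Hᵐᵒᵖ →ₐ[k] H := Algebra.TensorProduct.lift (AlgHom.id k H)
    ((Algebra.ofId k H).comp (counitOp k H)) hcomm
  have hi : ∀ a, φ (i a) = a := fun a => by simp [φ, i]
  have hj : ∀ r, φ (j r) = algebraMap k H (counitOp k H r) := fun a => by
    simp [φ, j, Algebra.ofId_apply]
  refine P.reduction i.toRingHom φ.toRingHom (j := j.toRingHom)
    (J := RingHom.ker (counitOp k H)) hi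
    (ker_le_closure_augmentation i j φ _ hi hj fun b => ?_) (fun r hr => ?_)
    (TensorProduct.projective_includeRight _) ?_
    (TrivialModule.counit k H) ?_ TrivialModule.counit_surjective ?_
  · induction b with
    | zero => exact zero_mem _
    | add x y hx hy => exact add_mem hx hy
    | tmul x y => exact AddSubmonoid.subset_closure ⟨y, x, by simp [i, j]⟩
  · exact (hj r).trans (by rw [(RingHom.mem_ker).1 hr, map_zero])
  -- Under right multiplication `H` is free of rank one over `Hᵐᵒᵖ`.
  · refine Module.Projective.compHom_of_addEquiv (N := Hᵐᵒᵖ) _ opAddEquiv.symm fun r x => ?_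
    exact ((enveloping_tmul_smul (k := k) 1 r (unop x)).trans (by simp)).symm
  · intro b m
    change Coalgebra.counit (R := k) (AlgHom.mulLeftRight k H b m) =
      Coalgebra.counit (R := k) (φ b) * Coalgebra.counit (R := k) m
    induction b with
    | zero => simp
    | add x y hx hy => rw [map_add, LinearMap.add_apply, map_add, map_add, map_add, hx, hy, add_mul]
    | tmul x y =>
      refine (counit_enveloping_tmul_smul x y m).trans ?_
      simp [φ, Algebra.ofId_apply]
  · intro m hm
    -- If `ε(m) = 0`, then `1 ⊗ op m` lies in `ker φ`, and it carries `1` to `m`.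
    have : m = (1 ⊗ₜ op m : H ⊗[k] Hᵐᵒᵖ) • (1 : H) := by simp [enveloping_tmul_smul]
    rw [this]
    exact Submodule.smul_mem_smul ((hj (op m)).trans
      ((congrArg (algebraMap k H) hm).trans (map_zero _))) trivial

theorem IsHomologicallySmooth.right (h : IsHomologicallySmooth k H) :
    Nonempty (BoundedFGProjectiveResolution Hᵐᵒᵖ (TrivialModule k H)) := by
  obtain ⟨P⟩ := h
  have hcomm : ∀ (x : H) (y : Hᵐᵒᵖ), Commute ((Algebra.ofId k Hᵐᵒᵖ).comp
    (Bialgebra.counitAlgHom k H) x) (AlgHom.id k Hᵐᵒᵖ y) :=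
    fun x y => Algebra.commutes (Bialgebra.counitAlgHom k H x) y
  let i : Hᵐᵒᵖ →ₐ[k] H ⊗[k] Hᵐᵒᵖ := Algebra.TensorProduct.includeRight
  let j : H →ₐ[k] H ⊗[k] Hᵐᵒᵖ := Algebra.TensorProduct.includeLeft
  let φ : H ⊗[k] Hᵐᵒᵖ →ₐ[k] Hᵐᵒᵖ := Algebra.TensorProduct.lift
    ((Algebra.ofId k Hᵐᵒᵖ).comp (Bialgebra.counitAlgHom k H)) (AlgHom.id k Hᵐᵒᵖ) hcomm
  have hi : ∀ a, φ (i a) = a := fun a => by simp [φ, i]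
  have hj : ∀ r, φ (j r) = algebraMap k Hᵐᵒᵖ (Bialgebra.counitAlgHom k H r) := fun a => by
    simp [φ, j, Algebra.ofId_apply]
  refine P.reduction i.toRingHom φ.toRingHom (j := j.toRingHom)
    (J := RingHom.ker (Bialgebra.counitAlgHom k H)) hi
    (ker_le_closure_augmentation i j φ _ hi hj fun b => ?_) (fun r hr => ?_)
    (TensorProduct.projective_includeLeft _) ?_
    (TrivialModule.counit k H) ?_ TrivialModule.counit_surjective ?_
  · induction b with
    | zero => exact zero_mem _
    | add x y hx hy => exact add_mem hx hy
    | tmul x y => exact AddSubmonoid.subset_closure ⟨x, y, by simp [i, j]⟩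
  · exact (hj r).trans (by rw [(RingHom.mem_ker).1 hr, map_zero])
  · refine Module.Projective.compHom_of_addEquiv (N := H) _ (AddEquiv.refl H) fun r x => ?_
    exact ((enveloping_tmul_smul (k := k) r 1 x).trans (by simp)).symm
  · intro b m
    change Coalgebra.counit (R := k) (AlgHom.mulLeftRight k H b m) =
      counitOp k H (φ b) * Coalgebra.counit (R := k) m
    induction b with
    | zero => simp
    | add x y hx hy => rw [map_add, LinearMap.add_apply, map_add, map_add, map_add, hx, hy, add_mul]
    | tmul x y =>
      refine (counit_enveloping_tmul_smul x y m).trans ?_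
      simp [φ, Algebra.ofId_apply]
  · intro m hm
    have : m = (m ⊗ₜ 1 : H ⊗[k] Hᵐᵒᵖ) • (1 : H) := by simp [enveloping_tmul_smul]
    rw [this]
    exact Submodule.smul_mem_smul ((hj m).trans
      ((congrArg (algebraMap k Hᵐᵒᵖ) hm).trans (map_zero _))) trivial

end Enveloping

/-! ### Tensor products with an action twisted by an algebra homomorphism -/

section TwistedTensor

variable {k : Type*} [Field k] {R D B : Type*} [Ring R] [Ring D] [Ring B] [Algebra k R]
  [Algebra k D] [Algebra k B]

section Action

variable (R D) (P C : Type*) [AddCommGroup P] [Module k P] [Module R P] [IsScalarTower k R P]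
  [AddCommGroup C] [Module k C] [Module D C] [IsScalarTower k D C]

/-- The action of `R ⊗ D` on the tensor product of an `R`-module and a `D`-module. -/
noncomputable def tensorActionHom : R ⊗[k] D →ₐ[k] Module.End k (P ⊗[k] C) :=
  Module.endTensorEndAlgHom.comp
    (Algebra.TensorProduct.map (Algebra.lsmul k k P) (Algebra.lsmul k k C))

variable {R D P C} in
@[simp]
theorem tensorActionHom_tmul (r : R) (d : D) (p : P) (c : C) :
    tensorActionHom R D P C (r ⊗ₜ[k] d) (p ⊗ₜ c) = (r • p) ⊗ₜ[k] (d • c) := by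
  change Module.endTensorEndAlgHom (R := k) (S := k) (A := k) (Algebra.TensorProduct.map
    (Algebra.lsmul k k P) (Algebra.lsmul k k C) (r ⊗ₜ[k] d)) (p ⊗ₜ c) = _
  rw [Algebra.TensorProduct.map_tmul, Module.endTensorEndAlgHom_apply]
  rfl

end Action

/-- The tensor product `P ⊗ C` of an `R`-module and a `D`-module, regarded as a `B`-module by means
of an algebra homomorphism `Θ : B → R ⊗ D`. -/
def TwistedTensor (_Θ : B →ₐ[k] R ⊗[k] D) (P C : Type*) [AddCommGroup P] [Module k P]
    [AddCommGroup C] [Module k C] : Type _ :=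
  P ⊗[k] C

namespace TwistedTensor

variable (Θ : B →ₐ[k] R ⊗[k] D) (P P' P'' C : Type*)
  [AddCommGroup P] [Module k P] [Module R P] [IsScalarTower k R P]
  [AddCommGroup P'] [Module k P'] [Module R P'] [IsScalarTower k R P']
  [AddCommGroup P''] [Module k P''] [Module R P''] [IsScalarTower k R P'']
  [AddCommGroup C] [Module k C] [Module D C] [IsScalarTower k D C]

instance : AddCommGroup (TwistedTensor Θ P C) := inferInstanceAs (AddCommGroup (P ⊗[k] C))

noncomputable instance : Module B (TwistedTensor Θ P C) :=
  Module.compHom (P ⊗[k] C) ((tensorActionHom R D P C).comp Θ).toRingHom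

/-- The identity map from the tensor product. -/
def of : P ⊗[k] C ≃+ TwistedTensor Θ P C := AddEquiv.refl _

variable {P P' P'' C}

theorem smul_of (b : B) (x : P ⊗[k] C) :
    b • of Θ P C x = of Θ P C (tensorActionHom R D P C (Θ b) x) := rfl

variable (C) in
/-- Functoriality in the first factor. -/
noncomputable def map (f : P →ₗ[R] P') : TwistedTensor Θ P C →ₗ[B] TwistedTensor Θ P' C where
  toFun x := of Θ P' C ((f.restrictScalars k).rTensor C ((of Θ P C).symm x))
  map_add' x y := by simp
  map_smul' b x := by
    obtain ⟨x, rfl⟩ := (of Θ P C).surjective x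
    rw [RingHom.id_apply, smul_of, smul_of, AddEquiv.symm_apply_apply, AddEquiv.symm_apply_apply]
    congr 1
    generalize Θ b = t
    induction t with
    | zero => simp
    | add s t hs ht => simp only [map_add, LinearMap.add_apply, hs, ht]
    | tmul r d =>
      induction x with
      | zero => simp
      | add x y hx hy => simp only [map_add, hx, hy]
      | tmul p c => simp

theorem map_of (f : P →ₗ[R] P') (x : P ⊗[k] C) :
    map Θ C f (of Θ P C x) = of Θ P' C ((f.restrictScalars k).rTensor C x) := rfl

theorem map_surjective {f : P →ₗ[R] P'} (hf : Function.Surjective f) :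
    Function.Surjective (map Θ C f) :=
  LinearMap.rTensor_surjective C (g := f.restrictScalars k) hf

theorem map_exact {f : P →ₗ[R] P'} {g : P' →ₗ[R] P''} (h : Function.Exact f g) :
    Function.Exact (map Θ C f) (map Θ C g) :=
  Module.Flat.rTensor_exact C (f := f.restrictScalars k) (g := g.restrictScalars k) h

/-- `P` is a summand of some `R^n` and `P ↦ P ⊗ C` is additive, so finiteness and projectivity need
checking only for `P = R`. -/
theorem exists_retract [Module.Finite R P] [Module.Projective R P] :
    ∃ (n : ℕ) (f : TwistedTensor Θ P C →ₗ[B] (Fin n → TwistedTensor Θ R C))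
      (g : (Fin n → TwistedTensor Θ R C) →ₗ[B] TwistedTensor Θ P C), g ∘ₗ f = LinearMap.id := by
  obtain ⟨n, p, s, -, -, hps⟩ := Module.Finite.exists_comp_eq_id_of_projective R P
  refine ⟨n, LinearMap.pi fun l => map Θ C (LinearMap.proj l ∘ₗ s),
    ∑ l, map Θ C (p ∘ₗ LinearMap.single R (fun _ => R) l) ∘ₗ LinearMap.proj l, ?_⟩
  ext x
  obtain ⟨x, rfl⟩ := (of Θ P C).surjective x
  simp only [LinearMap.comp_apply, LinearMap.sum_apply, LinearMap.proj_apply, LinearMap.pi_apply,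
    map_of, LinearMap.id_apply]
  rw [← map_sum]
  congr 1
  induction x with
  | zero => simp
  | add x y hx hy => simp only [map_add, Finset.sum_add_distrib, hx, hy]
  | tmul x c =>
    simp only [LinearMap.rTensor_tmul, ← TensorProduct.sum_tmul]
    congr 1
    refine Eq.trans ?_ (LinearMap.congr_fun hps x)
    rw [LinearMap.comp_apply]
    conv_rhs => rw [← LinearMap.sum_single_apply (fun _ => R) (s x)]
    simp

theorem finite [Module.Finite R P] [Module.Projective R P]
    [Module.Finite B (TwistedTensor Θ R C)] : Module.Finite B (TwistedTensor Θ P C) := by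
  obtain ⟨n, f, g, h⟩ := exists_retract (P := P) (C := C) Θ
  exact Module.Finite.of_surjective g fun x => ⟨f x, LinearMap.congr_fun h x⟩

theorem projective [Module.Finite R P] [Module.Projective R P]
    [Module.Projective B (TwistedTensor Θ R C)] : Module.Projective B (TwistedTensor Θ P C) := by
  obtain ⟨n, f, g, h⟩ := exists_retract (P := P) (C := C) Θ
  have : Module.Projective B (Fin n → TwistedTensor Θ R C) :=
    Module.Projective.of_equiv'
      (DirectSum.linearEquivFunOnFintype B (Fin n) fun _ => TwistedTensor Θ R C)
  exact Module.Projective.of_split f g h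

end TwistedTensor

end TwistedTensor

/-- Twisted tensor products with `C` carry bounded resolutions by finitely generated projective
`R`-modules to such resolutions over `B`, provided that they carry `R` to a finitely generated
projective `B`-module. -/
theorem BoundedFGProjectiveResolution.twistedTensor {k : Type*} [Field k] {R B : Type v} {D : Type*}
    [Ring R] [Ring D] [Ring B] [Algebra k R] [Algebra k D] [Algebra k B] (Θ : B →ₐ[k] R ⊗[k] D)
    (C : Type v) [AddCommGroup C] [Module k C] [Module D C] [IsScalarTower k D C]
    [Module.Finite B (TwistedTensor Θ R C)] [Module.Projective B (TwistedTensor Θ R C)]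
    {M : Type*} [AddCommGroup M] [Module k M] [Module R M] [IsScalarTower k R M]
    (P : BoundedFGProjectiveResolution R M) :
    Nonempty (BoundedFGProjectiveResolution B (TwistedTensor Θ M C)) := by
  let _ : ∀ n, Module k (P.X n) := fun n => Module.compHom (P.X n) (algebraMap k R)
  have : ∀ n, IsScalarTower k R (P.X n) := fun n =>
    ⟨fun c r x => by rw [Algebra.smul_def, mul_smul]; rfl⟩
  exact ⟨{
    X := fun n => TwistedTensor Θ (P.X n) C
    d := fun n => TwistedTensor.map Θ C (P.d n)
    aug := TwistedTensor.map Θ C P.aug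
    finite := fun n => have := P.finite n; have := P.projective n; TwistedTensor.finite Θ
    projective := fun n => have := P.finite n; have := P.projective n; TwistedTensor.projective Θ
    bounded := by
      obtain ⟨n, hn⟩ := P.bounded
      refine ⟨n, fun m hm => ?_⟩
      have := hn m hm
      exact inferInstanceAs (Subsingleton (P.X m ⊗[k] C))
    aug_surjective := TwistedTensor.map_surjective Θ P.aug_surjective
    exact_zero := TwistedTensor.map_exact Θ P.exact_zero
    exact_succ := fun n => TwistedTensor.map_exact Θ (P.exact_succ n) }⟩

/-! ### Galois maps of a Hopf algebra -/

section Galois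

open Coalgebra LinearMap

variable {k H : Type*} [CommRing k] [Ring H]

section

variable [Bialgebra k H]

/-- The map `a ⊗ b ↦ a₁ ⊗ u(a₂) b`. -/
noncomputable def leftGalois (u : H →ₗ[k] H) : H ⊗[k] H →ₗ[k] H ⊗[k] H :=
  (mul' k H).lTensor H ∘ₗ (TensorProduct.assoc k H H H).toLinearMap ∘ₗ
    (u.lTensor H ∘ₗ comul).rTensor H

/-- The map `a ⊗ b ↦ a u(b₁) ⊗ b₂`. -/
noncomputable def rightGalois (u : H →ₗ[k] H) : H ⊗[k] H →ₗ[k] H ⊗[k] H :=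
  (mul' k H).rTensor H ∘ₗ (TensorProduct.assoc k H H H).symm.toLinearMap ∘ₗ
    (u.rTensor H ∘ₗ comul).lTensor H

theorem leftGalois_tmul (u : H →ₗ[k] H) (a b : H) :
    leftGalois u (a ⊗ₜ b) = (mulRight k b ∘ₗ u).lTensor H (comul a) := by
  simp only [leftGalois, comp_apply, rTensor_tmul]
  induction comul (R := k) a with
  | zero => simp
  | add x y hx hy => simp only [map_add, TensorProduct.add_tmul, hx, hy]
  | tmul x y => simp

theorem rightGalois_tmul (u : H →ₗ[k] H) (a b : H) :
    rightGalois u (a ⊗ₜ b) = (mulLeft k a ∘ₗ u).rTensor H (comul b) := by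
  simp only [rightGalois, comp_apply, lTensor_tmul]
  induction comul (R := k) b with
  | zero => simp
  | add x y hx hy => simp only [map_add, TensorProduct.tmul_add, hx, hy]
  | tmul x y => simp

/-- Composition of these maps is convolution of their parameters, by coassociativity. Inverting the
Galois map thus reduces to inverting `id` under convolution, which the antipode does. -/
theorem leftGalois_leftGalois (u w : H →ₗ[k] H) (x : H ⊗[k] H) :
    leftGalois u (leftGalois w x) = leftGalois (mul' k H ∘ₗ TensorProduct.map u w ∘ₗ comul) x := by
  induction x with
  | zero => simp
  | add x y hx hy => simp only [map_add, hx, hy]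
  | tmul a b =>
    rw [leftGalois_tmul, leftGalois_tmul]
    have key : ∀ t : H ⊗[k] H, leftGalois u ((mulRight k b ∘ₗ w).lTensor H t) =
        (mulRight k b ∘ₗ mul' k H ∘ₗ TensorProduct.map u w).lTensor H
          (TensorProduct.assoc k H H H (comul.rTensor H t)) := by
      intro t
      induction t with
      | zero => simp
      | add x y hx hy => simp only [map_add, hx, hy]
      | tmul x z =>
        simp only [lTensor_tmul, rTensor_tmul, leftGalois_tmul]
        induction comul (R := k) x with
        | zero => simp
        | add x y hx hy => simp only [map_add, TensorProduct.add_tmul, hx, hy]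
        | tmul x y => simp [mul_assoc]
    rw [key, coassoc_apply, ← comp_apply, ← lTensor_comp]
    rfl

/-- Here convolution occurs in the reverse order: `w` acts on `b₁` before `u` acts on `b₂`. -/
theorem rightGalois_rightGalois (u w : H →ₗ[k] H) (x : H ⊗[k] H) :
    rightGalois u (rightGalois w x) =
      rightGalois (mul' k H ∘ₗ TensorProduct.map w u ∘ₗ comul) x := by
  induction x with
  | zero => simp
  | add x y hx hy => simp only [map_add, hx, hy]
  | tmul a b =>
    rw [rightGalois_tmul, rightGalois_tmul]
    have key : ∀ t : H ⊗[k] H, rightGalois u ((mulLeft k a ∘ₗ w).rTensor H t) =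
        (mulLeft k a ∘ₗ mul' k H ∘ₗ TensorProduct.map w u).rTensor H
          ((TensorProduct.assoc k H H H).symm (comul.lTensor H t)) := by
      intro t
      induction t with
      | zero => simp
      | add x y hx hy => simp only [map_add, hx, hy]
      | tmul z x =>
        simp only [lTensor_tmul, rTensor_tmul, rightGalois_tmul]
        induction comul (R := k) x with
        | zero => simp
        | add x y hx hy => simp only [map_add, TensorProduct.tmul_add, hx, hy]
        | tmul x y => simp
    rw [key, coassoc_symm_apply, ← comp_apply, ← rTensor_comp]
    rfl

theorem leftGalois_counit (x : H ⊗[k] H) :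
    leftGalois (Algebra.linearMap k H ∘ₗ counit) x = x := by
  induction x with
  | zero => simp
  | add x y hx hy => simp only [map_add, hx, hy]
  | tmul a b =>
    rw [leftGalois_tmul, ← comp_assoc, lTensor_comp, comp_apply, lTensor_counit_comul]
    simp

theorem rightGalois_counit (x : H ⊗[k] H) :
    rightGalois (Algebra.linearMap k H ∘ₗ counit) x = x := by
  induction x with
  | zero => simp
  | add x y hx hy => simp only [map_add, hx, hy]
  | tmul a b =>
    rw [rightGalois_tmul, ← comp_assoc, rTensor_comp, comp_apply, rTensor_counit_comul]
    simp

end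

variable [HopfAlgebra k H]

theorem leftGalois_bijective : Function.Bijective (leftGalois (LinearMap.id : H →ₗ[k] H)) := by
  refine Function.bijective_iff_has_inverse.2
    ⟨leftGalois (HopfAlgebra.antipode k), fun x => ?_, fun x => ?_⟩
  · rw [leftGalois_leftGalois]
    exact (congrArg (fun u => leftGalois u x)
      HopfAlgebra.mul_antipode_rTensor_comul).trans (leftGalois_counit x)
  · rw [leftGalois_leftGalois]
    exact (congrArg (fun u => leftGalois u x)
      HopfAlgebra.mul_antipode_lTensor_comul).trans (leftGalois_counit x)

theorem rightGalois_bijective : Function.Bijective (rightGalois (LinearMap.id : H →ₗ[k] H)) := by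
  refine Function.bijective_iff_has_inverse.2
    ⟨rightGalois (HopfAlgebra.antipode k), fun x => ?_, fun x => ?_⟩
  · rw [rightGalois_rightGalois]
    exact (congrArg (fun u => rightGalois u x)
      HopfAlgebra.mul_antipode_lTensor_comul).trans (rightGalois_counit x)
  · rw [rightGalois_rightGalois]
    exact (congrArg (fun u => rightGalois u x)
      HopfAlgebra.mul_antipode_rTensor_comul).trans (rightGalois_counit x)

end Galois

/-! ### From resolutions of the trivial modules to bimodule resolutions of `H` -/

section EnvelopingTwist

open MulOpposite Coalgebra

variable (k : Type u) (H : Type v) [Field k] [Ring H]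

attribute [local instance] instModuleEnveloping

section

variable [Algebra k H]

theorem isScalarTower_enveloping : IsScalarTower k (H ⊗[k] Hᵐᵒᵖ) H :=
  ⟨fun c b x => by
    rw [enveloping_smul_def, enveloping_smul_def, map_smul, LinearMap.smul_apply]⟩

end

attribute [local instance] isScalarTower_enveloping

namespace TrivialModule

variable [Bialgebra k H]

instance : Module k (TrivialModule k H) := inferInstanceAs (Module k k)

instance : IsScalarTower k H (TrivialModule k H) :=
  ⟨fun c h x => by
    change Coalgebra.counit (R := k) (c • h) * (show k from x) =
      c * (Coalgebra.counit (R := k) h * (show k from x))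
    rw [map_smul, smul_eq_mul, mul_assoc]⟩

instance : IsScalarTower k Hᵐᵒᵖ (TrivialModule k H) :=
  ⟨fun c h x => by
    change Coalgebra.counit (R := k) (c • unop h) * (show k from x) =
      c * (Coalgebra.counit (R := k) (unop h) * (show k from x))
    rw [map_smul, smul_eq_mul, mul_assoc]⟩

end TrivialModule

section

variable [Bialgebra k H]

/-- The comultiplication in the left variable, `a ⊗ c ↦ a₁ ⊗ (a₂ ⊗ c)`. -/
noncomputable def leftTwist : H ⊗[k] Hᵐᵒᵖ →ₐ[k] H ⊗[k] (H ⊗[k] Hᵐᵒᵖ) :=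
  (Algebra.TensorProduct.assoc k k k H H Hᵐᵒᵖ).toAlgHom.comp
    (Algebra.TensorProduct.map (Bialgebra.comulAlgHom k H) (AlgHom.id k Hᵐᵒᵖ))

/-- The comultiplication of the opposite algebra. -/
noncomputable def comulOp : Hᵐᵒᵖ →ₐ[k] Hᵐᵒᵖ ⊗[k] Hᵐᵒᵖ :=
  (Algebra.TensorProduct.opAlgEquiv k k H H).symm.toAlgHom.comp
    (AlgHom.op (Bialgebra.comulAlgHom k H))

/-- The comultiplication in the right variable, `a ⊗ c ↦ c₂ ⊗ (a ⊗ c₁)`. -/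
noncomputable def rightTwist : H ⊗[k] Hᵐᵒᵖ →ₐ[k] Hᵐᵒᵖ ⊗[k] (H ⊗[k] Hᵐᵒᵖ) :=
  (Algebra.TensorProduct.comm k (H ⊗[k] Hᵐᵒᵖ) Hᵐᵒᵖ).toAlgHom.comp
    ((Algebra.TensorProduct.assoc k k k H Hᵐᵒᵖ Hᵐᵒᵖ).symm.toAlgHom.comp
      (Algebra.TensorProduct.map (AlgHom.id k H) (comulOp k H)))

variable {k H}

/-- The action `a₁p ⊗ a₂xc`, written as a linear image of `comul a` so that the counit axiom and the
Galois map apply directly. -/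
theorem leftTwist_action {P : Type*} [AddCommGroup P] [Module k P] [Module H P]
    [IsScalarTower k H P] (a : H) (c : Hᵐᵒᵖ) (p : P) (x : H) :
    tensorActionHom H (H ⊗[k] Hᵐᵒᵖ) P H (leftTwist k H (a ⊗ₜ c)) (p ⊗ₜ x) =
      TensorProduct.map ((LinearMap.toSpanSingleton H P p).restrictScalars k)
        (LinearMap.mulRight k (x * unop c)) (comul a) := by
  have : leftTwist k H (a ⊗ₜ c) =
      Algebra.TensorProduct.assoc k k k H H Hᵐᵒᵖ (comul a ⊗ₜ c) := rfl
  rw [this]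
  induction comul (R := k) a with
  | zero => simp
  | add x y hx hy => simp only [TensorProduct.add_tmul, map_add, LinearMap.add_apply, hx, hy]
  | tmul y z =>
    rw [Algebra.TensorProduct.assoc_tmul, tensorActionHom_tmul, enveloping_tmul_smul]
    simp [mul_assoc]

/-- The action `pc₂ ⊗ axc₁`: the second leg of `comul c` acts on `P`, which matches `rightGalois`.
-/
theorem rightTwist_action {P : Type*} [AddCommGroup P] [Module k P] [Module Hᵐᵒᵖ P]
    [IsScalarTower k Hᵐᵒᵖ P] (a c : H) (p : P) (x : H) :
    tensorActionHom Hᵐᵒᵖ (H ⊗[k] Hᵐᵒᵖ) P H (rightTwist k H (a ⊗ₜ op c)) (p ⊗ₜ x) =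
      TensorProduct.comm k H P (TensorProduct.map (LinearMap.mulLeft k (a * x))
        ((LinearMap.toSpanSingleton Hᵐᵒᵖ P p).restrictScalars k ∘ₗ
          (opLinearEquiv k).toLinearMap) (comul c)) := by
  have : rightTwist k H (a ⊗ₜ op c) = Algebra.TensorProduct.comm k (H ⊗[k] Hᵐᵒᵖ) Hᵐᵒᵖ
      ((Algebra.TensorProduct.assoc k k k H Hᵐᵒᵖ Hᵐᵒᵖ).symm
        (a ⊗ₜ (TensorProduct.map (opLinearEquiv k).toLinearMap
          (opLinearEquiv k).toLinearMap (comul c)))) := rfl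
  rw [this]
  induction comul (R := k) c with
  | zero => simp
  | add x y hx hy => simp only [TensorProduct.tmul_add, map_add, LinearMap.add_apply, hx, hy]
  | tmul y z =>
    simp only [TensorProduct.map_tmul, Algebra.TensorProduct.assoc_symm_tmul,
      Algebra.TensorProduct.comm_tmul, LinearEquiv.coe_coe, coe_opLinearEquiv]
    rw [tensorActionHom_tmul, enveloping_tmul_smul]
    simp [mul_assoc]

variable (k H) in
/-- Tensoring with the trivial module changes nothing. -/
noncomputable def TrivialModule.lid : TrivialModule k H ⊗[k] H ≃ₗ[k] H := TensorProduct.lid k H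

theorem TrivialModule.lid_tmul (c : TrivialModule k H) (x : H) :
    TrivialModule.lid k H (c ⊗ₜ x) = (show k from c) • x := rfl

theorem TrivialModule.toSpanSingleton_left (p : TrivialModule k H) :
    (LinearMap.toSpanSingleton H (TrivialModule k H) p).restrictScalars k =
      LinearMap.toSpanSingleton k (TrivialModule k H) p ∘ₗ Coalgebra.counit := rfl

theorem TrivialModule.toSpanSingleton_right (p : TrivialModule k H) :
    (LinearMap.toSpanSingleton Hᵐᵒᵖ (TrivialModule k H) p).restrictScalars k ∘ₗ
        (opLinearEquiv k).toLinearMap =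
      LinearMap.toSpanSingleton k (TrivialModule k H) p ∘ₗ Coalgebra.counit := rfl

theorem smul_mul_mul_assoc (t : k) (a x c : H) : t • (a * (x * c)) = a * t • x * c := by
  simp [mul_assoc]

/-- The twist of the trivial left module is the bimodule `H`. -/
noncomputable def leftTwistTrivial :
    TwistedTensor (leftTwist k H) (TrivialModule k H) H ≃ₗ[H ⊗[k] Hᵐᵒᵖ] H :=
  { (TwistedTensor.of _ _ _).symm.trans (TrivialModule.lid k H).toAddEquiv with
    map_smul' := fun b z => by
      obtain ⟨z, rfl⟩ := (TwistedTensor.of _ _ _).surjective z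
      change TrivialModule.lid k H (tensorActionHom _ _ _ _ (leftTwist k H b) z) =
        AlgHom.mulLeftRight k H b (TrivialModule.lid k H z)
      induction b with
      | zero => simp only [map_zero, LinearMap.zero_apply]
      | add b c hb hc => simp only [map_add, LinearMap.add_apply, hb, hc]
      | tmul a c =>
        induction z with
        | zero => simp only [map_zero]
        | add x y hx hy => simp only [map_add, hx, hy]
        | tmul p x =>
          -- On the trivial module `a₁` acts by `ε(a₁)`, and the counit axiom collapses `ε(a₁)a₂` to
          -- `a`.
          rw [leftTwist_action, TrivialModule.toSpanSingleton_left, ← LinearMap.map_comp_rTensor,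
            LinearMap.comp_apply, rTensor_counit_comul, TensorProduct.map_tmul,
            TrivialModule.lid_tmul, TrivialModule.lid_tmul, AlgHom.mulLeftRight_apply,
            LinearMap.toSpanSingleton_apply, one_smul]
          exact smul_mul_mul_assoc (show k from p) a x (unop c) }

/-- The twist of the trivial right module is the bimodule `H`. -/
noncomputable def rightTwistTrivial :
    TwistedTensor (rightTwist k H) (TrivialModule k H) H ≃ₗ[H ⊗[k] Hᵐᵒᵖ] H :=
  { (TwistedTensor.of _ _ _).symm.trans (TrivialModule.lid k H).toAddEquiv with
    map_smul' := fun b z => by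
      obtain ⟨z, rfl⟩ := (TwistedTensor.of _ _ _).surjective z
      change TrivialModule.lid k H (tensorActionHom _ _ _ _ (rightTwist k H b) z) =
        AlgHom.mulLeftRight k H b (TrivialModule.lid k H z)
      induction b with
      | zero => simp only [map_zero, LinearMap.zero_apply]
      | add b c hb hc => simp only [map_add, LinearMap.add_apply, hb, hc]
      | tmul a c =>
        obtain ⟨c, rfl⟩ := op_surjective c
        induction z with
        | zero => simp only [map_zero]
        | add x y hx hy => simp only [map_add, hx, hy]
        | tmul p x =>
          rw [rightTwist_action, TrivialModule.toSpanSingleton_right,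
            ← LinearMap.map_comp_lTensor,
            LinearMap.comp_apply, lTensor_counit_comul, TensorProduct.map_tmul,
            TensorProduct.comm_tmul,
            TrivialModule.lid_tmul, TrivialModule.lid_tmul, AlgHom.mulLeftRight_apply,
            LinearMap.toSpanSingleton_apply, one_smul, LinearMap.mulLeft_apply, mul_assoc a x]
          exact smul_mul_mul_assoc (show k from p) a x c }

end

variable [HopfAlgebra k H]

/-- The twist of the left regular module is free of rank one over the enveloping algebra. -/
noncomputable def leftTwistSelf :
    (H ⊗[k] Hᵐᵒᵖ) ≃ₗ[H ⊗[k] Hᵐᵒᵖ] TwistedTensor (leftTwist k H) H H :=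
  LinearEquiv.ofBijective
    (LinearMap.toSpanSingleton _ _ (TwistedTensor.of (leftTwist k H) H H (1 ⊗ₜ 1))) <| by
    -- Since `(a ⊗ c)(1 ⊗ 1) = a₁ ⊗ a₂c`, the orbit map of `1 ⊗ 1` is the Galois map.
    have key : ∀ b : H ⊗[k] Hᵐᵒᵖ, b • TwistedTensor.of (leftTwist k H) H H (1 ⊗ₜ 1) =
        TwistedTensor.of (leftTwist k H) H H (leftGalois LinearMap.id
          (TensorProduct.congr (LinearEquiv.refl k H) (opLinearEquiv k).symm b)) := by
      intro b
      induction b with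
      | zero => rw [TwistedTensor.smul_of]; simp only [map_zero, LinearMap.zero_apply]
      | add x y hx hy => simp only [add_smul, map_add, hx, hy]
      | tmul a c =>
        rw [TwistedTensor.smul_of, leftTwist_action]
        have h1 : (LinearMap.toSpanSingleton H H (1 : H)).restrictScalars k = LinearMap.id := by
          ext; simp
        simp [leftGalois_tmul, LinearMap.lTensor, h1]
    have : ⇑(LinearMap.toSpanSingleton (H ⊗[k] Hᵐᵒᵖ) _
        (TwistedTensor.of (leftTwist k H) H H (1 ⊗ₜ 1))) = _ := funext key
    rw [this]
    exact (TwistedTensor.of _ H H).bijective.comp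
      (leftGalois_bijective.comp (LinearEquiv.bijective _))

/-- The twist of the right regular module is free of rank one over the enveloping algebra. -/
noncomputable def rightTwistSelf :
    (H ⊗[k] Hᵐᵒᵖ) ≃ₗ[H ⊗[k] Hᵐᵒᵖ] TwistedTensor (rightTwist k H) Hᵐᵒᵖ H :=
  LinearEquiv.ofBijective
    (LinearMap.toSpanSingleton _ _ (TwistedTensor.of (rightTwist k H) Hᵐᵒᵖ H (1 ⊗ₜ 1))) <| by
    -- Here `(a ⊗ c)(1 ⊗ 1) = c₂ ⊗ ac₁`, which is the right Galois map followed by the flip.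
    have key : ∀ b : H ⊗[k] Hᵐᵒᵖ, b • TwistedTensor.of (rightTwist k H) Hᵐᵒᵖ H (1 ⊗ₜ 1) =
        TwistedTensor.of (rightTwist k H) Hᵐᵒᵖ H (TensorProduct.comm k H Hᵐᵒᵖ
          (TensorProduct.congr (LinearEquiv.refl k H) (opLinearEquiv k) (rightGalois LinearMap.id
          (TensorProduct.congr (LinearEquiv.refl k H) (opLinearEquiv k).symm b)))) := by
      intro b
      induction b with
      | zero => rw [TwistedTensor.smul_of]; simp only [map_zero, LinearMap.zero_apply]
      | add x y hx hy => simp only [add_smul, map_add, hx, hy]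
      | tmul a c =>
        obtain ⟨c, rfl⟩ := op_surjective c
        rw [TwistedTensor.smul_of, rightTwist_action]
        have h1 : (LinearMap.toSpanSingleton Hᵐᵒᵖ Hᵐᵒᵖ (1 : Hᵐᵒᵖ)).restrictScalars k =
            LinearMap.id := by
          ext; simp
        have h2 : TensorProduct.congr (LinearEquiv.refl k H) (opLinearEquiv k)
            (TensorProduct.map (LinearMap.mulLeft k a) LinearMap.id (comul c)) =
            TensorProduct.map (LinearMap.mulLeft k a) (opLinearEquiv k).toLinearMap (comul c) := by
          induction comul (R := k) c with
          | zero => simp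
          | add x y hx hy => simp only [map_add, hx, hy]
          | tmul x y => simp
        simp [rightGalois_tmul, LinearMap.rTensor, h1, h2]
    have : ⇑(LinearMap.toSpanSingleton (H ⊗[k] Hᵐᵒᵖ) _
        (TwistedTensor.of (rightTwist k H) Hᵐᵒᵖ H (1 ⊗ₜ 1))) = _ := funext key
    rw [this]
    exact (TwistedTensor.of _ Hᵐᵒᵖ H).bijective.comp ((LinearEquiv.bijective _).comp
      ((LinearEquiv.bijective _).comp (rightGalois_bijective.comp (LinearEquiv.bijective _))))

variable {k H}

theorem IsHomologicallySmooth.of_left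
    (h : Nonempty (BoundedFGProjectiveResolution H (TrivialModule k H))) :
    IsHomologicallySmooth k H := by
  obtain ⟨P⟩ := h
  have := Module.Finite.equiv (leftTwistSelf k H)
  have := Module.Projective.of_equiv' (leftTwistSelf k H)
  obtain ⟨Q⟩ := P.twistedTensor (leftTwist k H) H
  exact ⟨Q.ofEquiv leftTwistTrivial⟩

theorem IsHomologicallySmooth.of_right
    (h : Nonempty (BoundedFGProjectiveResolution Hᵐᵒᵖ (TrivialModule k H))) :
    IsHomologicallySmooth k H := by
  obtain ⟨P⟩ := h
  have := Module.Finite.equiv (rightTwistSelf k H)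
  have := Module.Projective.of_equiv' (rightTwistSelf k H)
  obtain ⟨Q⟩ := P.twistedTensor (rightTwist k H) H
  exact ⟨Q.ofEquiv rightTwistTrivial⟩

end EnvelopingTwist

theorem proposition2p5 (k : Type u) (H : Type v) [Field k] [Ring H] [HopfAlgebra k H] :
    List.TFAE [
      IsHomologicallySmooth k H,
      Nonempty (BoundedFGProjectiveResolution H (TrivialModule k H)),
      Nonempty (BoundedFGProjectiveResolution Hᵐᵒᵖ (TrivialModule k H))] := by
  tfae_have 1 → 2 := IsHomologicallySmooth.left
  tfae_have 1 → 3 := IsHomologicallySmooth.right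
  tfae_have 2 → 1 := IsHomologicallySmooth.of_left
  tfae_have 3 → 1 := IsHomologicallySmooth.of_right
  tfae_finish
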